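/- **Theorem 1.1.** For real $s\in(0,1)$ and $p>1$ with $sp=1$ and a measurable $u:\mathbb R\to\mathbb R$ put $$[u]:=\left(\int_{\mathbb R}\int_{\mathbb R}\frac{|u(x)-u(y)|^p}{|x-y|^2}\,dx\,dy\right)^{1/p},\qquad \|u\|_{W^{s,p}(\mathbb R)}:=\left(\|u\|_{L^p(\mathbb R)}^p+[u]^p\right)^{1/p},$$ and let $W^{s,p}(\mathbb R)=\{u\in L^p(\mathbb R):[u]<\infty\}$. For a nonempty bounded open interval $I\subset\mathbb R$ let $\tilde W^{s,p}_0(I)$ be the closure of $C_c^\infty(I)$ in $W^{s,p}(\mathbb R)$ with respect to $\|\cdot\|_{W^{s,p}(\mathbb R)}$, where functions in $C_c^\infty(I)$ are extended by zero, and for $\alpha\ge 0$ put $$S(\alpha,I):=\sup_{u\in\tilde W^{s,p}_0(I),\ [u]\le 1}\int_I e^{\alpha|u|^{1/(1-s)}}\,dx\in[0,\infty].$$ Let $s\in(0,1)$ and $p>1$ be such that $sp=1$. Then: 1. there exists $\alpha_*=\alpha_*(s)>0$, depending only on $s$, such that $S(\alpha,I)<\infty$ for every nonempty bounded open interval $I$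 and every $\alpha\in[0,\alpha_*)$; 2. with $$\gamma_s:=8\,\Gamma(p+1)\sum_{k=0}^\infty\frac1{(1+2k)^p},\qquad \alpha^*:=\gamma_s^{\frac{s}{1-s}},$$ one has $S(\alpha,I)=\infty$ for every nonempty bounded open interval $I$ and every $\alpha\in(\alpha^*,\infty)$. -/

import Mathlib

open MeasureTheory
open scoped ContDiff

noncomputable section

namespace FracMT

/-- The Gagliardo seminorm `[u]_{W^{s,p}(ℝ)}` of a real function on the line in the critical case
`s p = 1`, where the kernel `|x - y|^{-(1 + s p)}` is `|x - y|^{-2}`, as an extended non-negative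
real: `(∬ |u x - u y| ^ p / |x - y| ^ 2 dx dy) ^ (1 / p)`. -/
def gagliardo (p : ℝ) (u : ℝ → ℝ) : ENNReal :=
  (∫⁻ y : ℝ, ∫⁻ x : ℝ, ENNReal.ofReal (|u x - u y| ^ p / |x - y| ^ 2)) ^ (1 / p)

/-- The full norm `(‖u‖_{L^p(ℝ)} ^ p + [u] ^ p) ^ (1 / p)`. -/
def sobolevNorm (p : ℝ) (u : ℝ → ℝ) : ENNReal :=
  (eLpNorm u (ENNReal.ofReal p) volume ^ p + gagliardo p u ^ p) ^ (1 / p)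

/-- Membership in the Sobolev-Slobodeckij space `W^{s,p}(ℝ)`, `s p = 1`: `u ∈ L^p(ℝ)` with finite
Gagliardo seminorm. -/
def MemSobolev (p : ℝ) (u : ℝ → ℝ) : Prop :=
  MemLp u (ENNReal.ofReal p) volume ∧ gagliardo p u < ⊤

/-- `C^∞_0(I)`: smooth functions on the line with compact support contained in `I`. -/
def IsTest (I : Set ℝ) (φ : ℝ → ℝ) : Prop :=
  ContDiff ℝ ∞ φ ∧ HasCompactSupport φ ∧ tsupport φ ⊆ I

/-- Membership in `W̃^{s,p}_0(I)`, `s p = 1`: the closure of `C^∞_0(I)` in `W^{s,p}(ℝ)` with respect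
to the full norm. -/
def MemSobolevZero (p : ℝ) (I : Set ℝ) (u : ℝ → ℝ) : Prop :=
  MemSobolev p u ∧
    ∀ ε : ENNReal, 0 < ε → ∃ φ : ℝ → ℝ, IsTest I φ ∧ sobolevNorm p (fun x => u x - φ x) < ε

/-- `∫_I exp (α |u| ^ (1 / (1 - s))) dx`, as an extended non-negative real. -/
def expIntegral (s α : ℝ) (I : Set ℝ) (u : ℝ → ℝ) : ENNReal :=
  ∫⁻ x in I, ENNReal.ofReal (Real.exp (α * |u x| ^ (1 / (1 - s))))

/-- The supremum of `∫_I exp (α |u| ^ (1 / (1 - s))) dx` over all `u ∈ W̃^{s,p}_0(I)` with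
Gagliardo seminorm at most one. -/
def moserTrudingerSup (s p α : ℝ) (I : Set ℝ) : ENNReal :=
  ⨆ u ∈ {u : ℝ → ℝ | MemSobolevZero p I u ∧ gagliardo p u ≤ 1}, expIntegral s α I u

/-- `γ_s = 8 Γ(p + 1) ∑_{k ≥ 0} (1 + 2 k) ^ (-p)`, where `p = 1 / s`. The series converges since
`p > 1`. -/
def gammaConst (p : ℝ) : ℝ :=
  8 * Real.Gamma (p + 1) * ∑' k : ℕ, 1 / (1 + 2 * (k : ℝ)) ^ p

end FracMT

end

/-!
For the first part, let `t k` be the dyadic quantiles of `|u|`, so that `{|u| > t k}` has measure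
at most `l / 2 ^ k` while `{|u| ≥ t (k + 1)}` has measure at least `l / 2 ^ (k + 1)`. The kernel
`1 / |x - y| ^ 2` gives the pair `{|u| ≥ t (k + 1)}`, `{|u| ≤ t k}` a mass of at least `1 / 2`, so
the sum of `(t (k + 1) - t k) ^ p` is at most `2 [u] ^ p`. Hölder's inequality then bounds
`t n ^ (1 / (1 - s))` by a multiple of `n`, and the exponential integral is dominated by a geometric
series.

For the second part, take smooth truncations of `log |x|`. In logarithmic coordinates the energy
has the translation invariant kernel `2 cosh h / sinh h ^ 2`, whose `p`-th moment is exactly `γ_s`,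
so a profile of slope one and height `L` has energy at most `γ_s L + O(1)`. After normalisation its
plateau has width of order `exp (-L)` and height to the power `1 / (1 - s)` asymptotic to
`L / γ_s ^ (s / (1 - s))`.
-/

namespace FracMT

open Real Set Filter Topology
open scoped ENNReal

theorem lintegral_eq_setLIntegral_Ioi_add_Iio (g : ℝ → ℝ≥0∞) :
    ∫⁻ x, g x = (∫⁻ x in Ioi 0, g x) + ∫⁻ x in Iio 0, g x := by
  rw [setLIntegral_congr (Iio_ae_eq_Iic (μ := volume) (a := (0 : ℝ))), ← compl_Ioi,
    lintegral_add_compl _ measurableSet_Ioi]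

theorem lintegral_comp_abs (g : ℝ → ℝ≥0∞) :
    ∫⁻ x, g |x| = 2 * ∫⁻ x in Ioi (0 : ℝ), g x := by
  have hneg : ∫⁻ x in Iio (0 : ℝ), g |x| = ∫⁻ x in Ioi (0 : ℝ), g |x| := by
    simpa using ((Measure.measurePreserving_neg (volume : Measure ℝ)).setLIntegral_comp_emb
      (MeasurableEquiv.neg ℝ).measurableEmbedding (fun x => g |x|) (Ioi 0)).symm
  rw [lintegral_eq_setLIntegral_Ioi_add_Iio, hneg, two_mul]
  congr 1 <;> exact setLIntegral_congr_fun measurableSet_Ioi fun x hx => by rw [abs_of_pos hx]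

theorem lintegral_eq_lintegral_exp_add_neg_exp {g : ℝ → ℝ≥0∞} (hg : Measurable g) :
    ∫⁻ x, g x = ∫⁻ t, ENNReal.ofReal (exp t) * (g (exp t) + g (-exp t)) := by
  have hpos : ∫⁻ x in Ioi 0, g x = ∫⁻ t, ENNReal.ofReal (exp t) * g (exp t) := by
    simpa [range_exp] using lintegral_image_eq_lintegral_abs_deriv_mul MeasurableSet.univ
      (fun x _ => (hasDerivAt_exp x).hasDerivWithinAt) exp_injective.injOn g
  have hneg : ∫⁻ x in Iio 0, g x = ∫⁻ t, ENNReal.ofReal (exp t) * g (-exp t) := by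
    have himage : range (fun t => -exp t) = Iio 0 := by
      rw [← neg_zero, ← image_neg_Ioi, ← range_exp, ← range_comp]; rfl
    simpa [himage] using lintegral_image_eq_lintegral_abs_deriv_mul MeasurableSet.univ
      (fun x _ => (hasDerivAt_exp x).neg.hasDerivWithinAt)
      (neg_injective.comp exp_injective).injOn g
  rw [lintegral_eq_setLIntegral_Ioi_add_Iio, hpos, hneg, ← lintegral_add_left (by fun_prop)]
  simp only [mul_add]

theorem lintegral_eq_mul_lintegral_affine {ρ : ℝ} (hρ : ρ ≠ 0) (c : ℝ) (g : ℝ → ℝ≥0∞) :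
    ∫⁻ x, g x = ENNReal.ofReal |ρ| * ∫⁻ x, g (ρ * x + c) := by
  have hinj : Function.Injective fun x => ρ * x + c := (add_left_injective c).comp
    (mul_right_injective₀ hρ)
  have hsurj : Function.Surjective fun x => ρ * x + c := fun y => ⟨(y - c) / ρ, by field_simp; ring⟩
  have hderiv : ∀ x ∈ univ, HasDerivWithinAt (fun x => ρ * x + c) ρ univ x := fun x _ =>
    ((hasDerivAt_const_mul ρ).add_const c).hasDerivWithinAt
  have hchange := lintegral_image_eq_lintegral_abs_deriv_mul MeasurableSet.univ hderiv hinj.injOn g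
  rwa [image_univ, hsurj.range_eq, Measure.restrict_univ,
    lintegral_const_mul' _ _ ENNReal.ofReal_ne_top] at hchange

/-- The measure `dx dy / |x - y| ^ 2` in logarithmic coordinates: summed over the four choices of
signs in `x = ± exp t`, `y = ± exp r`, it becomes `logKernel (t - r) dt dr`. -/
noncomputable def logKernel (h : ℝ) : ℝ := 2 * cosh h / sinh h ^ 2

theorem logKernel_nonneg (h : ℝ) : 0 ≤ logKernel h :=
  div_nonneg (mul_nonneg zero_le_two (cosh_pos h).le) (sq_nonneg _)

@[fun_prop]
theorem measurable_logKernel : Measurable logKernel := by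
  unfold logKernel; fun_prop

theorem logKernel_abs (h : ℝ) : logKernel |h| = logKernel h := by
  rw [logKernel, cosh_abs]
  rcases abs_choice h with habs | habs <;> simp only [habs, sinh_neg, neg_sq, logKernel]

theorem exp_mul_exp_mul_kernel {t r : ℝ} (h : t ≠ r) :
    2 * (exp t * exp r) * (1 / (exp t - exp r) ^ 2 + 1 / (exp t + exp r) ^ 2) =
      logKernel (t - r) := by
  have hsub : exp t - exp r ≠ 0 := sub_ne_zero.2 (exp_injective.ne h)
  have hadd : exp t + exp r ≠ 0 := by positivity
  have hcosh : 2 * (exp t * exp r) * cosh (t - r) = exp t ^ 2 + exp r ^ 2 := by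
    rw [cosh_eq, neg_sub, exp_sub, exp_sub]; field_simp
  have hsinh : 2 * (exp t * exp r) * sinh (t - r) = (exp t - exp r) * (exp t + exp r) := by
    rw [sinh_eq, neg_sub, exp_sub, exp_sub]; field_simp; ring
  have hsinh0 : sinh (t - r) ≠ 0 := by simpa using sub_ne_zero.2 h
  calc _ = 2 * (exp t * exp r) *
        (2 * (exp t ^ 2 + exp r ^ 2) / ((exp t - exp r) * (exp t + exp r)) ^ 2) := by
        field_simp; ring
    _ = logKernel (t - r) := by rw [← hcosh, ← hsinh, logKernel]; field_simp

theorem hasSum_logKernel {h : ℝ} (hh : 0 < h) :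
    HasSum (fun k : ℕ => 4 * (1 + 2 * (k : ℝ)) * exp (-((1 + 2 * k) * h))) (logKernel h) := by
  set q := exp (-h) with hq
  have hq0 : 0 < q := exp_pos _
  have hq1 : q < 1 := exp_lt_one_iff.2 (neg_neg_of_pos hh)
  have hnorm : ‖q ^ 2‖ < 1 := by
    rw [norm_of_nonneg (by positivity)]; exact pow_lt_one₀ hq0.le hq1 two_ne_zero
  have hterm (k : ℕ) : 4 * (1 + 2 * (k : ℝ)) * exp (-((1 + 2 * k) * h)) =
      8 * q * (k * (q ^ 2) ^ k) + 4 * q * (q ^ 2) ^ k := by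
    have hexp : exp (-((1 + 2 * k) * h)) = q * (q ^ 2) ^ k := by
      rw [← pow_mul, ← pow_succ', hq, ← exp_nat_mul]
      congr 1; push_cast; ring
    rw [hexp]; ring
  have hvalue : 8 * q * (q ^ 2 / (1 - q ^ 2) ^ 2) + 4 * q * (1 - q ^ 2)⁻¹ = logKernel h := by
    have hexp : exp h = q⁻¹ := by rw [hq, exp_neg, inv_inv]
    have hq2 : 1 - q ^ 2 ≠ 0 := by nlinarith
    rw [logKernel, cosh_eq, sinh_eq, ← hq, hexp]
    field_simp
    ring
  rw [← hvalue]
  exact (((hasSum_coe_mul_geometric_of_norm_lt_one hnorm).mul_left (8 * q)).add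
    ((hasSum_geometric_of_norm_lt_one hnorm).mul_left (4 * q))).congr_fun hterm

theorem summable_one_div_odd_rpow {q : ℝ} (hq : 1 < q) :
    Summable fun k : ℕ => 1 / (1 + 2 * (k : ℝ)) ^ q := by
  refine ((summable_nat_add_iff 1).2 (summable_one_div_nat_rpow.2 hq)).of_nonneg_of_le
    (fun k => by positivity) fun k => ?_
  have : (0 : ℝ) ≤ k := k.cast_nonneg
  push_cast
  gcongr 1 / ?_ ^ q
  linarith

theorem gammaConst_pos {q : ℝ} (hq : 1 < q) : 0 < gammaConst q := by
  have hsum := (summable_one_div_odd_rpow hq).tsum_pos (fun k => by positivity) 0 (by simp)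
  have : 0 < Gamma (q + 1) := Gamma_pos_of_pos (by linarith)
  unfold gammaConst
  positivity

theorem lintegral_Ioi_rpow_mul_exp_neg {q n : ℝ} (hq : -1 < q) (hn : 0 < n) :
    ∫⁻ h in Ioi (0 : ℝ), ENNReal.ofReal (h ^ q * exp (-(n * h))) =
      ENNReal.ofReal ((1 / n) ^ (q + 1) * Gamma (q + 1)) := by
  have hint : IntegrableOn (fun x : ℝ => x ^ q * exp (-n * x ^ (1 : ℝ))) (Ioi 0) :=
    integrableOn_rpow_mul_exp_neg_mul_rpow hq one_pos hn
  rw [← Real.integral_rpow_mul_exp_neg_mul_Ioi (by linarith) hn,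
    ← ofReal_integral_eq_lintegral_ofReal]
  · simp only [add_sub_cancel_right]
  · exact hint.congr_fun (fun x _ => by simp) measurableSet_Ioi
  · filter_upwards [ae_restrict_mem measurableSet_Ioi] with x (hx : 0 < x)
    positivity

theorem lintegral_logKernel_mul_rpow {q : ℝ} (hq : 1 < q) :
    ∫⁻ h, ENNReal.ofReal (logKernel h * |h| ^ q) = ENNReal.ofReal (gammaConst q) := by
  have : 0 < Gamma (q + 1) := Gamma_pos_of_pos (by linarith)
  have hseries : ∀ h ∈ Ioi (0 : ℝ), ENNReal.ofReal (logKernel h * h ^ q) =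
      ∑' k : ℕ, ENNReal.ofReal (4 * (1 + 2 * k)) *
        ENNReal.ofReal (h ^ q * exp (-((1 + 2 * k) * h))) := fun h (hh : 0 < h) => by
    have hsum := (hasSum_logKernel hh).mul_right (h ^ q)
    rw [← hsum.tsum_eq, ENNReal.ofReal_tsum_of_nonneg (fun k => by positivity) hsum.summable]
    refine tsum_congr fun k => ?_
    rw [← ENNReal.ofReal_mul (by positivity), mul_comm (h ^ q), mul_assoc]
  have hterm (k : ℕ) : ∫⁻ h in Ioi (0 : ℝ), ENNReal.ofReal (4 * (1 + 2 * k)) *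
        ENNReal.ofReal (h ^ q * exp (-((1 + 2 * k) * h))) =
      ENNReal.ofReal (4 * Gamma (q + 1) * (1 / (1 + 2 * (k : ℝ)) ^ q)) := by
    have hk : (0 : ℝ) < 1 + 2 * k := by positivity
    rw [lintegral_const_mul' _ _ ENNReal.ofReal_ne_top,
      lintegral_Ioi_rpow_mul_exp_neg (by linarith) hk, ← ENNReal.ofReal_mul (by positivity),
      div_rpow zero_le_one hk.le, one_rpow, rpow_add_one hk.ne']
    congr 1
    field_simp
  calc ∫⁻ h, ENNReal.ofReal (logKernel h * |h| ^ q)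
      = 2 * ∫⁻ h in Ioi (0 : ℝ), ENNReal.ofReal (logKernel h * h ^ q) := by
        simp_rw [← lintegral_comp_abs fun h => ENNReal.ofReal (logKernel h * h ^ q), logKernel_abs]
    _ = 2 * ∑' k : ℕ, ENNReal.ofReal (4 * Gamma (q + 1) * (1 / (1 + 2 * (k : ℝ)) ^ q)) := by
        rw [setLIntegral_congr_fun measurableSet_Ioi hseries,
          lintegral_tsum fun k => by fun_prop]
        simp_rw [hterm]
    _ = ENNReal.ofReal (gammaConst q) := by
        rw [← ENNReal.ofReal_tsum_of_nonneg (fun k => by positivity)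
          ((summable_one_div_odd_rpow hq).mul_left _), tsum_mul_left, ← ENNReal.ofReal_ofNat 2,
          ← ENNReal.ofReal_mul zero_le_two, gammaConst]
        congr 1; ring

/-- The Gagliardo energy `[u] ^ p`, that is, `gagliardo p u` before the `p`-th root is taken. -/
noncomputable def energy (p : ℝ) (u : ℝ → ℝ) : ℝ≥0∞ :=
  ∫⁻ y, ∫⁻ x, ENNReal.ofReal (|u x - u y| ^ p / |x - y| ^ 2)

theorem gagliardo_le_one_iff {p : ℝ} (hp : 0 < p) {u : ℝ → ℝ} :
    gagliardo p u ≤ 1 ↔ energy p u ≤ 1 :=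
  ⟨fun h => not_lt.1 fun hlt => not_lt.2 h (ENNReal.one_lt_rpow hlt (one_div_pos.2 hp)),
    fun h => ENNReal.rpow_le_one h (one_div_pos.2 hp).le⟩

theorem energy_congr_ae {p : ℝ} {u v : ℝ → ℝ} (h : u =ᵐ[volume] v) :
    energy p u = energy p v := by
  refine lintegral_congr_ae ?_
  filter_upwards [h] with y hy
  refine lintegral_congr_ae ?_
  filter_upwards [h] with x hx
  rw [hx, hy]

theorem energy_const_mul (p κ : ℝ) (u : ℝ → ℝ) :
    energy p (fun x => κ * u x) = ENNReal.ofReal (|κ| ^ p) * energy p u := by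
  unfold energy
  simp_rw [← mul_sub, abs_mul, mul_rpow (abs_nonneg _) (abs_nonneg _), mul_div_assoc,
    ENNReal.ofReal_mul (rpow_nonneg (abs_nonneg κ) p),
    lintegral_const_mul' _ _ ENNReal.ofReal_ne_top]

theorem energy_comp_affine {p ρ : ℝ} (hρ : ρ ≠ 0) (c : ℝ) (u : ℝ → ℝ) :
    energy p (fun x => u ((x - c) / ρ)) = energy p u := by
  have hcancel (x : ℝ) : (ρ * x + c - c) / ρ = x := by field_simp; ring
  have hscale (x y : ℝ) : |ρ| * (|ρ| * (|u x - u y| ^ p / |ρ * x + c - (ρ * y + c)| ^ 2)) =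
      |u x - u y| ^ p / |x - y| ^ 2 := by
    rw [add_sub_add_right_eq_sub, ← mul_sub, abs_mul, mul_pow]
    field_simp
  unfold energy
  rw [lintegral_eq_mul_lintegral_affine hρ c, ← lintegral_const_mul' _ _ ENNReal.ofReal_ne_top]
  refine lintegral_congr fun y => ?_
  rw [lintegral_eq_mul_lintegral_affine hρ c, ← lintegral_const_mul' _ _ ENNReal.ofReal_ne_top,
    ← lintegral_const_mul' _ _ ENNReal.ofReal_ne_top]
  refine lintegral_congr fun x => ?_
  simp only [hcancel]
  rw [← ENNReal.ofReal_mul (abs_nonneg ρ), ← ENNReal.ofReal_mul (abs_nonneg ρ), hscale]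

theorem energy_comp_log {p : ℝ} (hp : 0 < p) {F : ℝ → ℝ} (hF : Measurable F) :
    energy p (fun x => F (log x)) =
      ∫⁻ r, ∫⁻ t, ENNReal.ofReal (logKernel (t - r) * |F t - F r| ^ p) := by
  set G : ℝ → ℝ → ℝ≥0∞ := fun y x =>
    ENNReal.ofReal (|F (log x) - F (log y)| ^ p / |x - y| ^ 2) with hG
  have hGm : Measurable (Function.uncurry G) := by unfold Function.uncurry; fun_prop
  have hsym (y : ℝ) : ∫⁻ x, G (-y) x = ∫⁻ x, G y x := by
    rw [← lintegral_neg_eq_self]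
    refine lintegral_congr fun x => ?_
    simp only [hG, log_neg_eq_log, ← abs_neg (-x - -y)]
    congr 4; ring
  have hpoint (r t : ℝ) : ENNReal.ofReal (exp r) * (2 * (ENNReal.ofReal (exp t) *
      (G (exp r) (exp t) + G (exp r) (-exp t)))) =
      ENNReal.ofReal (logKernel (t - r) * |F t - F r| ^ p) := by
    simp only [hG, log_exp, log_neg_eq_log]
    rcases eq_or_ne t r with rfl | h
    · simp [hp.ne']
    rw [← ENNReal.ofReal_add (by positivity) (by positivity), ← ENNReal.ofReal_ofNat 2,
      ← ENNReal.ofReal_mul (exp_pos _).le, ← ENNReal.ofReal_mul zero_le_two,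
      ← ENNReal.ofReal_mul (exp_pos _).le, ← exp_mul_exp_mul_kernel h, sq_abs, sq_abs,
      ← neg_add', neg_sq]
    congr 1; ring
  calc energy p (fun x => F (log x)) = ∫⁻ y, ∫⁻ x, G y x := rfl
    _ = ∫⁻ r, ENNReal.ofReal (exp r) * (2 * ∫⁻ x, G (exp r) x) := by
        rw [lintegral_eq_lintegral_exp_add_neg_exp hGm.lintegral_prod_right]
        simp_rw [hsym, ← two_mul]
    _ = ∫⁻ r, ∫⁻ t, ENNReal.ofReal (logKernel (t - r) * |F t - F r| ^ p) := by
        refine lintegral_congr fun r => ?_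
        rw [lintegral_eq_lintegral_exp_add_neg_exp hGm.of_uncurry_left,
          ← lintegral_const_mul' _ _ ENNReal.ofNat_ne_top,
          ← lintegral_const_mul' _ _ ENNReal.ofReal_ne_top]
        exact lintegral_congr (hpoint r)

theorem energy_comp_log_eq_lintegral_translate {p : ℝ} (hp : 0 < p) {F : ℝ → ℝ}
    (hF : Measurable F) : energy p (fun x => F (log x)) =
      ∫⁻ h, ENNReal.ofReal (logKernel h) * ∫⁻ r, ENNReal.ofReal (|F (h + r) - F r| ^ p) := by
  have htranslate (r : ℝ) : ∫⁻ t, ENNReal.ofReal (logKernel (t - r) * |F t - F r| ^ p) =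
      ∫⁻ h, ENNReal.ofReal (logKernel h * |F (h + r) - F r| ^ p) := by
    rw [← lintegral_add_right_eq_self _ r]
    simp only [add_sub_cancel_right]
  simp_rw [energy_comp_log hp hF, htranslate]
  rw [lintegral_lintegral_swap (by fun_prop)]
  simp_rw [ENNReal.ofReal_mul (logKernel_nonneg _),
    lintegral_const_mul' _ _ ENNReal.ofReal_ne_top]

theorem lintegral_abs_translate_sub_rpow_le {p : ℝ} (hp : 0 < p) {F : ℝ → ℝ} {A B : ℝ}
    (hF : LipschitzWith 1 F) (hA : ∀ t ≤ A, F t = F A) (hB : ∀ t, B ≤ t → F t = F B) (h : ℝ) :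
    ∫⁻ r, ENNReal.ofReal (|F (h + r) - F r| ^ p) ≤
      ENNReal.ofReal (|h| ^ p * (B - A + 2 * |h|)) := by
  have hle := le_abs_self h
  have hge := neg_abs_le h
  have := abs_nonneg h
  have hpoint (r : ℝ) : ENNReal.ofReal (|F (h + r) - F r| ^ p) ≤
      (Icc (A - |h|) (B + |h|)).indicator (fun _ => ENNReal.ofReal (|h| ^ p)) r := by
    by_cases hr : r ∈ Icc (A - |h|) (B + |h|)
    · rw [indicator_of_mem hr]
      have hlip : |F (h + r) - F r| ≤ |h| := by
        simpa [Real.dist_eq] using hF.dist_le_mul (h + r) r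
      gcongr
    · have hconst : F (h + r) = F r := by
        rw [mem_Icc, not_and_or, not_le, not_le] at hr
        rcases hr with hr | hr
        · rw [hA r (by linarith), hA (h + r) (by linarith)]
        · rw [hB r (by linarith), hB (h + r) (by linarith)]
      simp [hconst, hp.ne']
  refine (lintegral_mono hpoint).trans_eq ?_
  rw [lintegral_indicator_const measurableSet_Icc, Real.volume_Icc,
    ← ENNReal.ofReal_mul (by positivity)]
  congr 2; ring

theorem energy_comp_log_le {p : ℝ} (hp : 1 < p) {F : ℝ → ℝ} {A B : ℝ} (hAB : A ≤ B)
    (hF : LipschitzWith 1 F) (hA : ∀ t ≤ A, F t = F A) (hB : ∀ t, B ≤ t → F t = F B) :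
    energy p (fun x => F (log x)) ≤
      ENNReal.ofReal ((B - A) * gammaConst p + 2 * gammaConst (p + 1)) := by
  have hp0 : 0 < p := by linarith
  have hlen : 0 ≤ B - A := sub_nonneg.2 hAB
  have hγ := gammaConst_pos hp
  have hγ' := gammaConst_pos (by linarith : 1 < p + 1)
  calc energy p (fun x => F (log x))
      ≤ ∫⁻ h, ENNReal.ofReal (logKernel h) * ENNReal.ofReal (|h| ^ p * (B - A + 2 * |h|)) := by
        rw [energy_comp_log_eq_lintegral_translate hp0 hF.continuous.measurable]
        gcongr with h
        exact lintegral_abs_translate_sub_rpow_le hp0 hF hA hB h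
    _ = ∫⁻ h, (ENNReal.ofReal (B - A) * ENNReal.ofReal (logKernel h * |h| ^ p) +
          ENNReal.ofReal 2 * ENNReal.ofReal (logKernel h * |h| ^ (p + 1))) := by
        refine lintegral_congr fun h => ?_
        have hK := logKernel_nonneg h
        rw [← ENNReal.ofReal_mul hK, ← ENNReal.ofReal_mul hlen, ← ENNReal.ofReal_mul zero_le_two,
          ← ENNReal.ofReal_add (by positivity) (by positivity),
          rpow_add_one' (abs_nonneg h) (by positivity)]
        congr 1; ring
    _ = ENNReal.ofReal ((B - A) * gammaConst p + 2 * gammaConst (p + 1)) := by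
        rw [lintegral_add_left (by fun_prop), lintegral_const_mul' _ _ ENNReal.ofReal_ne_top,
          lintegral_const_mul' _ _ ENNReal.ofReal_ne_top, lintegral_logKernel_mul_rpow hp,
          lintegral_logKernel_mul_rpow (by linarith), ← ENNReal.ofReal_mul hlen,
          ← ENNReal.ofReal_mul zero_le_two, ← ENNReal.ofReal_add (by positivity) (by positivity)]

theorem IsTest.const_mul {I : Set ℝ} {φ : ℝ → ℝ} (hφ : IsTest I φ) (κ : ℝ) :
    IsTest I fun x => κ * φ x :=
  ⟨contDiff_const.mul hφ.1, hφ.2.1.mul_left, tsupport_mul_subset_right.trans hφ.2.2⟩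

theorem IsTest.memSobolevZero {p : ℝ} (hp : 0 < p) {I : Set ℝ} {φ : ℝ → ℝ} (hφ : IsTest I φ)
    (hfin : gagliardo p φ < ⊤) : MemSobolevZero p I φ := by
  refine ⟨⟨hφ.1.continuous.memLp_of_hasCompactSupport hφ.2.1, hfin⟩, fun ε hε => ⟨φ, hφ, ?_⟩⟩
  simpa [sobolevNorm, gagliardo, hp, hp.ne'] using hε

theorem expIntegral_le_moserTrudingerSup {s p α : ℝ} {I : Set ℝ} {u : ℝ → ℝ}
    (hu : MemSobolevZero p I u) (hu1 : gagliardo p u ≤ 1) :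
    expIntegral s α I u ≤ moserTrudingerSup s p α I :=
  le_iSup₂ (f := fun v (_ : v ∈ {v | MemSobolevZero p I v ∧ gagliardo p v ≤ 1}) =>
    expIntegral s α I v) u ⟨hu, hu1⟩

theorem gagliardo_inv_rpow_mul_le_one {p Q : ℝ} (hp : 0 < p) (hQ : 0 < Q) {u : ℝ → ℝ}
    (hu : energy p u ≤ ENNReal.ofReal Q) :
    gagliardo p (fun x => (Q ^ (1 / p))⁻¹ * u x) ≤ 1 := by
  have hscale : |(Q ^ (1 / p))⁻¹| ^ p = Q⁻¹ := by
    rw [abs_of_pos (by positivity), inv_rpow (by positivity), ← rpow_mul hQ.le,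
      one_div_mul_cancel hp.ne', rpow_one]
  rw [gagliardo_le_one_iff hp, energy_const_mul, hscale]
  calc ENNReal.ofReal Q⁻¹ * energy p u
      ≤ ENNReal.ofReal Q⁻¹ * ENNReal.ofReal Q := by gcongr
    _ = 1 := by
      rw [← ENNReal.ofReal_mul (by positivity), inv_mul_cancel₀ hQ.ne', ENNReal.ofReal_one]

theorem le_moserTrudingerSup_of_isTest {s p α Q m : ℝ} (hs : s < 1) (hp : 0 < p) (hα : 0 ≤ α)
    (hQ : 0 < Q) (hm : 0 ≤ m) {I J : Set ℝ} (hJ : MeasurableSet J) (hJI : J ⊆ I) {φ : ℝ → ℝ}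
    (hφ : IsTest I φ) (hE : energy p φ ≤ ENNReal.ofReal Q) (hφm : ∀ x ∈ J, m ≤ |φ x|) :
    ENNReal.ofReal (exp (α * (m / Q ^ (1 / p)) ^ (1 / (1 - s)))) * volume J ≤
      moserTrudingerSup s p α I := by
  have hgag := gagliardo_inv_rpow_mul_le_one hp hQ hE
  have hmem := (hφ.const_mul (Q ^ (1 / p))⁻¹).memSobolevZero hp (hgag.trans_lt ENNReal.one_lt_top)
  refine le_trans ?_ (expIntegral_le_moserTrudingerSup hmem hgag)
  rw [← setLIntegral_const]
  refine (setLIntegral_mono' hJ fun x hx => ?_).trans (lintegral_mono_set hJI)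
  have : 0 ≤ 1 / (1 - s) := one_div_nonneg.2 (sub_nonneg.2 hs.le)
  rw [abs_mul, abs_of_pos (by positivity : 0 < (Q ^ (1 / p))⁻¹), div_eq_inv_mul]
  gcongr
  exact hφm x hx

/-- A smooth function `ℝ → [0, 1]` that equals one on `[1, L + 1]` and vanishes outside
`[0, L + 2]`; it is minus the slope of `ramp L`. -/
noncomputable def plateau (L t : ℝ) : ℝ := smoothTransition t * smoothTransition (L + 2 - t)

/-- The profile of the smoothed Moser functions in logarithmic coordinates: it is constant, at a
height at least `L`, on `(-∞, 0]`, decreases with slope at most one, and vanishes on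
`[L + 2, ∞)`. -/
noncomputable def ramp (L t : ℝ) : ℝ := ∫ τ in t..(L + 2), plateau L τ

/-- The smoothed Moser function `x ↦ ramp L (log |x|)`. Mathlib's `log` is even, and its junk value
`log 0 = 0` gives the right value at the origin since `ramp L` is constant on `(-∞, 0]`. -/
noncomputable def moser (L x : ℝ) : ℝ := ramp L (log x)

theorem contDiff_plateau (L : ℝ) : ContDiff ℝ ∞ (plateau L) :=
  smoothTransition.contDiff.mul (smoothTransition.contDiff.comp (contDiff_const.sub contDiff_id))

theorem plateau_nonneg (L t : ℝ) : 0 ≤ plateau L t :=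
  mul_nonneg (smoothTransition.nonneg _) (smoothTransition.nonneg _)

theorem plateau_le_one (L t : ℝ) : plateau L t ≤ 1 :=
  mul_le_one₀ (smoothTransition.le_one _) (smoothTransition.nonneg _) (smoothTransition.le_one _)

theorem intervalIntegrable_plateau (L a b : ℝ) : IntervalIntegrable (plateau L) volume a b :=
  (contDiff_plateau L).continuous.intervalIntegrable _ _

theorem hasDerivAt_ramp (L t : ℝ) : HasDerivAt (ramp L) (-plateau L t) t :=
  intervalIntegral.integral_hasDerivAt_left (intervalIntegrable_plateau _ _ _)
    ((contDiff_plateau L).continuous.stronglyMeasurableAtFilter _ _)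
    (contDiff_plateau L).continuous.continuousAt

theorem deriv_ramp (L : ℝ) : deriv (ramp L) = fun t => -plateau L t :=
  funext fun t => (hasDerivAt_ramp L t).deriv

theorem contDiff_ramp (L : ℝ) : ContDiff ℝ ∞ (ramp L) := by
  rw [contDiff_infty_iff_deriv, deriv_ramp]
  exact ⟨fun t => (hasDerivAt_ramp L t).differentiableAt, (contDiff_plateau L).neg⟩

theorem lipschitzWith_ramp (L : ℝ) : LipschitzWith 1 (ramp L) := by
  refine lipschitzWith_of_nnnorm_deriv_le (fun t => (hasDerivAt_ramp L t).differentiableAt)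
    fun t => ?_
  rw [← NNReal.coe_le_coe, coe_nnnorm, NNReal.coe_one, deriv_ramp, norm_neg,
    norm_of_nonneg (plateau_nonneg L t)]
  exact plateau_le_one L t

theorem ramp_of_nonpos {L t : ℝ} (ht : t ≤ 0) : ramp L t = ramp L 0 := by
  have hzero : ∫ τ in t..0, plateau L τ = 0 :=
    intervalIntegral.integral_zero_ae <| ae_of_all _ fun τ hτ => by
      rw [uIoc_of_le ht] at hτ
      simp [plateau, smoothTransition.zero_of_nonpos hτ.2]
  rw [ramp, ramp, ← intervalIntegral.integral_add_adjacent_intervals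
    (intervalIntegrable_plateau L t 0) (intervalIntegrable_plateau L 0 (L + 2)), hzero, zero_add]

theorem ramp_of_add_two_le {L t : ℝ} (ht : L + 2 ≤ t) : ramp L t = 0 :=
  intervalIntegral.integral_zero_ae <| ae_of_all _ fun τ hτ => by
    rw [uIoc_of_ge ht] at hτ
    simp [plateau, smoothTransition.zero_of_nonpos (sub_nonpos.2 hτ.1.le)]

theorem le_ramp_zero {L : ℝ} (hL : 0 ≤ L) : L ≤ ramp L 0 :=
  calc L = ∫ τ in (1 : ℝ)..(L + 1), plateau L τ := by
        rw [intervalIntegral.integral_congr (g := fun _ => (1 : ℝ)) fun τ hτ => ?_]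
        · simp
        · rw [uIcc_of_le (by linarith)] at hτ
          simp [plateau, smoothTransition.one_of_one_le hτ.1,
            smoothTransition.one_of_one_le (by linarith [hτ.2] : 1 ≤ L + 2 - τ)]
    _ ≤ ramp L 0 := intervalIntegral.integral_mono_interval zero_le_one (by linarith)
        (by linarith) (ae_of_all _ (plateau_nonneg L)) (intervalIntegrable_plateau _ _ _)

theorem moser_of_abs_le_one {L x : ℝ} (hx : |x| ≤ 1) : moser L x = ramp L 0 := by
  rw [moser, ← log_abs]
  exact ramp_of_nonpos (log_nonpos (abs_nonneg x) hx)

theorem contDiff_moser (L : ℝ) : ContDiff ℝ ∞ (moser L) := by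
  refine contDiff_iff_contDiffAt.2 fun x => ?_
  rcases eq_or_ne x 0 with rfl | hx
  · have hconst : moser L =ᶠ[𝓝 0] fun _ => ramp L 0 := by
      filter_upwards [Metric.closedBall_mem_nhds (0 : ℝ) one_pos] with x hx
      exact moser_of_abs_le_one (by simpa using hx)
    exact contDiffAt_const.congr_of_eventuallyEq hconst
  · exact (contDiff_ramp L).contDiffAt.comp x (contDiffAt_log.2 hx)

theorem abs_le_of_moser_ne_zero {L x : ℝ} (hx : moser L x ≠ 0) : |x| ≤ exp (L + 2) := by
  by_contra! hlt
  refine hx (ramp_of_add_two_le ?_)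
  rw [← log_abs, le_log_iff_exp_le ((exp_pos _).trans hlt)]
  exact hlt.le

theorem energy_moser_le {p L : ℝ} (hp : 1 < p) (hL : 0 ≤ L) :
    energy p (moser L) ≤
      ENNReal.ofReal (gammaConst p * L + 2 * (gammaConst p + gammaConst (p + 1))) := by
  refine (energy_comp_log_le hp (by linarith) (lipschitzWith_ramp L) (A := 0) (B := L + 2)
    (fun t => ramp_of_nonpos) fun t ht => ?_).trans_eq ?_
  · rw [ramp_of_add_two_le ht, ramp_of_add_two_le le_rfl]
  · congr 1; ring

theorem isTest_moser_comp_affine {L c ρ : ℝ} (hρ : 0 < ρ) {I : Set ℝ}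
    (hI : Metric.closedBall c (ρ * exp (L + 2)) ⊆ I) :
    IsTest I fun x => moser L ((x - c) / ρ) := by
  have hsupport : Function.support (fun x => moser L ((x - c) / ρ)) ⊆
      Metric.closedBall c (ρ * exp (L + 2)) := fun x hx => by
    have habs := abs_le_of_moser_ne_zero hx
    rwa [abs_div, abs_of_pos hρ, div_le_iff₀' hρ] at habs
  exact ⟨(contDiff_moser L).comp ((contDiff_id.sub contDiff_const).div_const ρ),
    .of_support_subset_isCompact (isCompact_closedBall _ _) hsupport,
    (closure_minimal hsupport Metric.isClosed_closedBall).trans hI⟩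

theorem le_moserTrudingerSup_of_closedBall_subset {s p α L c R : ℝ} (hs : s < 1) (hp : 1 < p)
    (hα : 0 ≤ α) (hL : 0 ≤ L) (hR : 0 < R) {I : Set ℝ} (hI : Metric.closedBall c R ⊆ I) :
    ENNReal.ofReal (exp (α * (L / (gammaConst p * L +
      2 * (gammaConst p + gammaConst (p + 1))) ^ (1 / p)) ^ (1 / (1 - s)))) *
      ENNReal.ofReal (2 * (R * exp (-(L + 2)))) ≤ moserTrudingerSup s p α I := by
  set ρ := R * exp (-(L + 2)) with hρ
  have hρ0 : 0 < ρ := by positivity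
  have hρR : ρ * exp (L + 2) = R := by rw [hρ, mul_assoc, ← exp_add]; simp
  have : 0 < gammaConst p := gammaConst_pos hp
  have : 0 < gammaConst (p + 1) := gammaConst_pos (by linarith)
  rw [← Real.volume_closedBall c]
  refine le_moserTrudingerSup_of_isTest hs (by linarith) hα (by positivity) hL
    measurableSet_closedBall ?_ (isTest_moser_comp_affine hρ0 (hρR ▸ hI)) ?_ fun x hx => ?_
  · refine (Metric.closedBall_subset_closedBall ?_).trans hI
    exact mul_le_of_le_one_right hR.le (exp_le_one_iff.2 (by linarith))
  · rw [energy_comp_affine hρ0.ne']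
    exact energy_moser_le hp hL
  · have hle : |(x - c) / ρ| ≤ 1 := by
      rwa [abs_div, abs_of_pos hρ0, div_le_one hρ0]
    rw [moser_of_abs_le_one hle]
    exact (le_ramp_zero hL).trans (le_abs_self _)

theorem div_rpow_rpow_one_div_one_sub {s x Q : ℝ} (hs : s < 1) (hx : 0 < x) (hQ : 0 < Q) :
    (x / Q ^ s) ^ (1 / (1 - s)) = x * (x / Q) ^ (s / (1 - s)) := by
  have hexp : 1 / (1 - s) = 1 + s / (1 - s) := by
    have : 1 - s ≠ 0 := by linarith
    field_simp; ring
  rw [div_rpow hx.le (by positivity), div_rpow hx.le hQ.le, ← rpow_mul hQ.le, mul_one_div, hexp,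
    rpow_add hx, rpow_one, mul_div_assoc]

theorem tendsto_exp_mul_exp_neg_atTop {γ C σ α : ℝ} (hγ : 0 < γ) (hσ : 0 ≤ σ)
    (hα : γ ^ σ < α) :
    Tendsto (fun L => exp (α * (L * (L / (γ * L + C)) ^ σ)) * exp (-L)) atTop atTop := by
  have hratio : Tendsto (fun L => L / (γ * L + C)) atTop (𝓝 γ⁻¹) := by
    have hlim : Tendsto (fun L => (γ + C / L)⁻¹) atTop (𝓝 (γ + 0)⁻¹) :=
      (tendsto_const_nhds.add (tendsto_const_nhds.div_atTop tendsto_id)).inv₀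
        (by simpa using hγ.ne')
    rw [add_zero] at hlim
    refine hlim.congr' ?_
    filter_upwards [eventually_ne_atTop 0] with L hL
    field_simp
  have hexponent : Tendsto (fun L => α * (L / (γ * L + C)) ^ σ - 1) atTop
      (𝓝 (α * γ⁻¹ ^ σ - 1)) := ((hratio.rpow_const (Or.inr hσ)).const_mul α).sub_const 1
  have hpos : 0 < α * γ⁻¹ ^ σ - 1 := by
    rwa [inv_rpow hγ.le, ← div_eq_mul_inv, sub_pos, one_lt_div (rpow_pos_of_pos hγ σ)]
  refine (tendsto_exp_atTop.comp (tendsto_id.atTop_mul_pos hpos hexponent)).congr fun L => ?_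
  rw [← exp_add, Function.comp_apply, id]
  congr 1; ring

theorem moserTrudingerSup_eq_top {s p α : ℝ} (hp : 1 < p) (hsp : s * p = 1)
    (hα : gammaConst p ^ (s / (1 - s)) < α) {I : Set ℝ} (hI : (interior I).Nonempty) :
    moserTrudingerSup s p α I = ⊤ := by
  have hs : s = 1 / p := eq_one_div_of_mul_eq_one_left hsp
  have hs0 : 0 < s := by rw [hs]; positivity
  have hs1 : s < 1 := by rw [hs, div_lt_one] <;> linarith
  have hγ : 0 < gammaConst p := gammaConst_pos hp
  have : 0 < gammaConst (p + 1) := gammaConst_pos (by linarith)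
  obtain ⟨c, hc⟩ := hI
  obtain ⟨R, hR, hball⟩ := Metric.nhds_basis_closedBall.mem_iff.1 (mem_interior_iff_mem_nhds.1 hc)
  have hlim := (tendsto_exp_mul_exp_neg_atTop (C := 2 * (gammaConst p + gammaConst (p + 1))) hγ
    (div_pos hs0 (sub_pos.2 hs1)).le hα).const_mul_atTop (by positivity : 0 < 2 * (R * exp (-2)))
  refine top_unique (le_of_tendsto (ENNReal.tendsto_ofReal_atTop.comp hlim) ?_)
  filter_upwards [eventually_gt_atTop 0] with L hL
  refine le_trans (le_of_eq ?_) (le_moserTrudingerSup_of_closedBall_subset hs1 hp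
    ((rpow_pos_of_pos hγ _).trans hα).le hL.le hR hball)
  rw [← ENNReal.ofReal_mul (exp_pos _).le, ← hs,
    div_rpow_rpow_one_div_one_sub hs1 hL (by positivity), neg_add, exp_add]
  simp only [Function.comp_apply]
  congr 1; ring

theorem MemSobolevZero.ae_eq_zero {p : ℝ} (hp : 0 < p) {I : Set ℝ} {u : ℝ → ℝ}
    (hu : MemSobolevZero p I u) : ∀ᵐ x, x ∉ I → u x = 0 := by
  have hle (v : ℝ → ℝ) : eLpNorm v (ENNReal.ofReal p) volume ≤ sobolevNorm p v :=
    calc _ = (eLpNorm v (ENNReal.ofReal p) volume ^ p) ^ (1 / p) := by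
          rw [← ENNReal.rpow_mul, mul_one_div_cancel hp.ne', ENNReal.rpow_one]
      _ ≤ sobolevNorm p v := by unfold sobolevNorm; gcongr; exact le_self_add
  have hmeas : MeasurableSet (interior I)ᶜ := isOpen_interior.measurableSet.compl
  have hzero : eLpNorm u (ENNReal.ofReal p) (volume.restrict (interior I)ᶜ) = 0 := by
    refine le_antisymm (le_of_forall_gt fun ε hε => ?_) zero_le
    obtain ⟨φ, hφ, hlt⟩ := hu.2 ε hε
    have hvanish : ∀ x ∈ (interior I)ᶜ, φ x = 0 := fun x hx => by
      by_contra hne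
      have hsub : Function.support φ ⊆ I := (subset_tsupport φ).trans hφ.2.2
      exact hx (interior_maximal hsub hφ.1.continuous.isOpen_support hne)
    calc eLpNorm u (ENNReal.ofReal p) (volume.restrict (interior I)ᶜ)
        = eLpNorm (fun x => u x - φ x) (ENNReal.ofReal p) (volume.restrict (interior I)ᶜ) := by
          refine eLpNorm_congr_ae ?_
          filter_upwards [ae_restrict_mem hmeas] with x hx
          rw [hvanish x hx, sub_zero]
      _ ≤ sobolevNorm p (fun x => u x - φ x) :=
          (eLpNorm_mono_measure _ Measure.restrict_le_self).trans (hle _)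
      _ < ε := hlt
  rw [eLpNorm_eq_zero_iff hu.1.1.1.restrict (by simpa using hp)] at hzero
  filter_upwards [(ae_restrict_iff' hmeas).1 hzero] with x hx hxI
  exact hx fun hxint => hxI (interior_subset hxint)

section Levels

variable {ν : Measure ℝ} {m : ℝ≥0∞} {c t : ℝ}

theorem measure_Ioi_le_of_forall_gt (h : ∀ r > t, ν (Ioi r) ≤ m) : ν (Ioi t) ≤ m := by
  obtain ⟨r, hanti, hgt, hlim⟩ := exists_seq_strictAnti_tendsto t
  have hmono : Monotone fun n => Ioi (r n) := fun i j hij => Ioi_subset_Ioi (hanti.antitone hij)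
  rw [← (isGLB_of_tendsto_atTop hanti.antitone hlim).iUnion_Ioi_eq, hmono.measure_iUnion]
  exact iSup_le fun n => h _ (hgt n)

theorem le_measure_Ici_of_forall_lt (hct : c < t) (hfin : ν (Ioi c) ≠ ⊤)
    (h : ∀ r ∈ Ico c t, m ≤ ν (Ioi r)) : m ≤ ν (Ici t) := by
  obtain ⟨r, hmono, hmem, hlim⟩ := exists_seq_strictMono_tendsto' hct
  have hanti : Antitone fun n => Ioi (r n) := fun i j hij => Ioi_subset_Ioi (hmono.monotone hij)
  have hInter : ⋂ n, Ioi (r n) = Ici t := by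
    rw [← compl_Iio, ← iUnion_Iic_eq_Iio_of_lt_of_tendsto (fun n => (hmem n).2) hlim, compl_iUnion]
    simp only [compl_Iic]
  rw [← hInter, hanti.measure_iInter (fun n => measurableSet_Ioi.nullMeasurableSet)
    ⟨0, measure_ne_top_of_subset (Ioi_subset_Ioi (hmem 0).1.le) hfin⟩]
  exact le_iInf fun n => h _ (Ioo_subset_Ico_self (hmem n))

theorem exists_level (hfin : ν (Ioi c) ≠ ⊤) (hm : 0 < m) :
    ∃ t ≥ c, ν (Ioi t) ≤ m ∧ ∀ r ∈ Ico c t, m < ν (Ioi r) := by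
  set S := {r | c ≤ r ∧ ν (Ioi r) ≤ m}
  have hbdd : BddBelow S := ⟨c, fun r hr => hr.1⟩
  have hne : S.Nonempty := by
    have hlim := tendsto_measure_iInter_atTop (fun r : ℝ => measurableSet_Ioi.nullMeasurableSet)
      antitone_Ioi ⟨c, hfin⟩
    have hempty : ⋂ r : ℝ, Ioi r = ∅ := iInter_eq_empty_iff.2 fun x => ⟨x, lt_irrefl x⟩
    rw [hempty, measure_empty] at hlim
    exact ((eventually_ge_atTop c).and (hlim.eventually_le_const hm)).exists
  refine ⟨sInf S, le_csInf hne fun r hr => hr.1, measure_Ioi_le_of_forall_gt fun r hr => ?_,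
    fun r hr => ?_⟩
  · obtain ⟨r', hr', hlt⟩ := exists_lt_of_csInf_lt hne hr
    exact (measure_mono (Ioi_subset_Ioi hlt.le)).trans hr'.2
  · by_contra! hle
    exact hr.2.not_ge (csInf_le hbdd ⟨hr.1, hle⟩)

theorem exists_dyadic_levels {l : ℝ} (hl : 0 < l) (hν : ν (Ioi 0) ≤ ENNReal.ofReal l) :
    ∃ t : ℕ → ℝ, t 0 = 0 ∧ Monotone t ∧ (∀ k, ν (Ioi (t k)) ≤ ENNReal.ofReal (l / 2 ^ k)) ∧
      ∀ k, t k < t (k + 1) → ENNReal.ofReal (l / 2 ^ (k + 1)) ≤ ν (Ici (t (k + 1))) := by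
  have hfin : ν (Ioi 0) ≠ ⊤ := ne_top_of_le_ne_top ENNReal.ofReal_ne_top hν
  choose t ht0 hle hlt using fun k : ℕ =>
    exists_level hfin (ENNReal.ofReal_pos.2 (by positivity : 0 < l / 2 ^ k))
  refine ⟨t, ?_, monotone_nat_of_le_succ fun k => ?_, hle, fun k hk => ?_⟩
  · by_contra hne
    have hgt := hlt 0 0 ⟨le_rfl, (ht0 0).lt_of_ne' hne⟩
    rw [pow_zero, div_one] at hgt
    exact hgt.not_ge hν
  · by_contra! hk
    refine (hlt k _ ⟨ht0 _, hk⟩).not_ge ((hle (k + 1)).trans (ENNReal.ofReal_le_ofReal ?_))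
    gcongr
    · norm_num
    · exact k.le_succ
  · exact le_measure_Ici_of_forall_lt ((ht0 k).trans_lt hk) hfin fun r hr => (hlt (k + 1) r hr).le

end Levels

theorem sum_lintegral_le {ι X : Type*} [MeasurableSpace X] {μ : Measure X} (s : Finset ι)
    (g : ι → X → ℝ≥0∞) : ∑ i ∈ s, ∫⁻ x, g i x ∂μ ≤ ∫⁻ x, ∑ i ∈ s, g i x ∂μ := by
  classical
  induction s using Finset.induction_on with
  | empty => simp
  | insert i s hi ih =>
    simp only [Finset.sum_insert hi]
    exact (add_le_add_right ih _).trans (le_lintegral_add _ _)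

theorem ofReal_inv_le_lintegral_kernel {B : Set ℝ} (hB : MeasurableSet B) {m : ℝ} (hm : 0 < m)
    (hvol : volume Bᶜ ≤ ENNReal.ofReal m) (y : ℝ) :
    ENNReal.ofReal m⁻¹ ≤ ∫⁻ x in B, ENNReal.ofReal (1 / |x - y| ^ 2) := by
  set J := Metric.closedBall y m
  have hJ : MeasurableSet J := measurableSet_closedBall
  have hJB : ENNReal.ofReal m ≤ volume (J \ Bᶜ) :=
    calc ENNReal.ofReal m = ENNReal.ofReal (2 * m) - ENNReal.ofReal m := by
          rw [← ENNReal.ofReal_sub _ hm.le]; congr 1; ring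
      _ ≤ volume J - volume Bᶜ := by rw [Real.volume_closedBall]; gcongr
      _ ≤ volume (J \ Bᶜ) := le_measure_sdiff
  calc ENNReal.ofReal m⁻¹ = ENNReal.ofReal (1 / m ^ 2) * ENNReal.ofReal m := by
        rw [← ENNReal.ofReal_mul (by positivity)]; congr 1; field_simp
    _ ≤ ENNReal.ofReal (1 / m ^ 2) * volume (J \ Bᶜ) := by gcongr
    _ = ∫⁻ x in J \ Bᶜ, ENNReal.ofReal (1 / m ^ 2) := by rw [setLIntegral_const]
    _ ≤ ∫⁻ x in J \ Bᶜ, ENNReal.ofReal (1 / |x - y| ^ 2) := by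
        refine lintegral_mono_ae ?_
        filter_upwards [ae_restrict_mem (hJ.diff hB.compl),
          ae_restrict_of_ae (Measure.ae_ne volume y)] with x hx hxy
        have hdist : |x - y| ≤ m := hx.1
        have : 0 < |x - y| := abs_pos.2 (sub_ne_zero.2 hxy)
        gcongr
    _ ≤ ∫⁻ x in B, ENNReal.ofReal (1 / |x - y| ^ 2) :=
        lintegral_mono_set fun x hx => not_not.1 hx.2

theorem sum_level_gap_rpow_le {p : ℝ} (hp : 1 ≤ p) {t : ℕ → ℝ} (ht : Monotone t) (a b : ℝ)
    (n : ℕ) : ∑ k ∈ Finset.range n, (if t (k + 1) ≤ |b| ∧ |a| ≤ t k then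
      (t (k + 1) - t k) ^ p else 0) ≤ |a - b| ^ p := by
  -- Clamping the levels to `[|a|, |b|]` keeps every gap that occurs in the sum.
  set τ : ℕ → ℝ := fun k => min |b| (max (t k) |a|)
  have hτ : Monotone τ := fun i j hij => min_le_min_left _ (max_le_max_right _ (ht hij))
  have hgap (k : ℕ) : (if t (k + 1) ≤ |b| ∧ |a| ≤ t k then (t (k + 1) - t k) ^ p else 0) ≤
      (τ (k + 1) - τ k) ^ p := by
    split_ifs with h
    · have hk := ht k.le_succ
      simp only [τ, max_eq_left (h.2.trans hk), max_eq_left h.2, min_eq_right h.1,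
        min_eq_right (hk.trans h.1), le_refl]
    · exact rpow_nonneg (sub_nonneg.2 (hτ k.le_succ)) p
  have hsum : ∑ k ∈ Finset.range n, (τ (k + 1) - τ k) ^ p ≤ (τ n - τ 0) ^ p := by
    induction n with
    | zero => simp [(by linarith : p ≠ 0)]
    | succ n ih =>
      rw [Finset.sum_range_succ, ← sub_add_sub_cancel' (τ n) (τ 0)]
      exact (add_le_add_left ih _).trans (add_rpow_le_rpow_add (sub_nonneg.2 (hτ n.zero_le))
        (sub_nonneg.2 (hτ n.le_succ)) hp)
  refine (Finset.sum_le_sum fun k _ => hgap k).trans (hsum.trans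
    (rpow_le_rpow (sub_nonneg.2 (hτ n.zero_le)) ?_ (by linarith)))
  have hn : τ n ≤ |b| := min_le_left _ _
  have h0 : min |b| |a| ≤ τ 0 := min_le_min_left _ (le_max_right _ _)
  have habs := abs_sub_abs_le_abs_sub b a
  rw [abs_sub_comm] at habs
  rcases min_choice |b| |a| with h | h <;> rw [h] at h0
  · linarith [abs_nonneg (a - b)]
  · linarith

theorem sum_gap_rpow_mul_interaction_le_energy {p : ℝ} (hp : 1 ≤ p) {u : ℝ → ℝ}
    (hu : Measurable u) {t : ℕ → ℝ} (ht : Monotone t) (n : ℕ) :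
    ∑ k ∈ Finset.range n, ENNReal.ofReal ((t (k + 1) - t k) ^ p) *
      ∫⁻ y in {y | t (k + 1) ≤ |u y|}, ∫⁻ x in {x | |u x| ≤ t k}, ENNReal.ofReal (1 / |x - y| ^ 2) ≤
      energy p u := by
  have hgap (k : ℕ) : 0 ≤ (t (k + 1) - t k) ^ p := rpow_nonneg (sub_nonneg.2 (ht k.le_succ)) p
  set w : ℕ → ℝ → ℝ → ℝ := fun k y x =>
    if t (k + 1) ≤ |u y| ∧ |u x| ≤ t k then (t (k + 1) - t k) ^ p else 0
  have hw (k : ℕ) (y x : ℝ) : 0 ≤ w k y x := ite_nonneg (hgap k) le_rfl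
  have hterm (k : ℕ) : ENNReal.ofReal ((t (k + 1) - t k) ^ p) *
      ∫⁻ y in {y | t (k + 1) ≤ |u y|}, ∫⁻ x in {x | |u x| ≤ t k}, ENNReal.ofReal (1 / |x - y| ^ 2) =
      ∫⁻ y, ∫⁻ x, ENNReal.ofReal (w k y x * (1 / |x - y| ^ 2)) := by
    rw [← lintegral_const_mul' _ _ ENNReal.ofReal_ne_top,
      ← lintegral_indicator (measurableSet_le measurable_const hu.abs)]
    refine lintegral_congr fun y => ?_
    by_cases hy : t (k + 1) ≤ |u y|
    · rw [indicator_of_mem (mem_ofPred_eq ▸ hy), ← lintegral_const_mul' _ _ ENNReal.ofReal_ne_top,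
        ← lintegral_indicator (measurableSet_le hu.abs measurable_const)]
      refine lintegral_congr fun x => ?_
      by_cases hx : |u x| ≤ t k <;> simp [w, hx, hy, ENNReal.ofReal_mul (hgap k)]
    · simp [w, hy]
  simp_rw [hterm]
  refine (sum_lintegral_le _ _).trans (lintegral_mono fun y =>
    (sum_lintegral_le _ _).trans (lintegral_mono fun x => ?_))
  rw [← ENNReal.ofReal_sum_of_nonneg fun k _ => mul_nonneg (hw k y x) (by positivity),
    ← Finset.sum_mul, div_eq_mul_one_div (|u x - u y| ^ p)]
  gcongr
  exact sum_level_gap_rpow_le hp ht (u x) (u y) n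

theorem sum_gap_rpow_le_two_mul_energy {p : ℝ} (hp : 1 ≤ p) {u : ℝ → ℝ} (hu : Measurable u) {l : ℝ}
    (hl : 0 < l) {t : ℕ → ℝ} (ht : Monotone t)
    (hle : ∀ k, volume {x | t k < |u x|} ≤ ENNReal.ofReal (l / 2 ^ k))
    (hge : ∀ k, t k < t (k + 1) →
      ENNReal.ofReal (l / 2 ^ (k + 1)) ≤ volume {x | t (k + 1) ≤ |u x|}) (n : ℕ) :
    ENNReal.ofReal (∑ k ∈ Finset.range n, (t (k + 1) - t k) ^ p) ≤ 2 * energy p u := by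
  have hgap (k : ℕ) : 0 ≤ (t (k + 1) - t k) ^ p := rpow_nonneg (sub_nonneg.2 (ht k.le_succ)) p
  have hinteraction (k : ℕ) (hk : t k < t (k + 1)) : 1 ≤ 2 * ∫⁻ y in {y | t (k + 1) ≤ |u y|},
      ∫⁻ x in {x | |u x| ≤ t k}, ENNReal.ofReal (1 / |x - y| ^ 2) :=
    calc 1 = 2 * (ENNReal.ofReal (l / 2 ^ k)⁻¹ * ENNReal.ofReal (l / 2 ^ (k + 1))) := by
          rw [← ENNReal.ofReal_ofNat 2, ← ENNReal.ofReal_mul (by positivity),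
            ← ENNReal.ofReal_mul zero_le_two, ← ENNReal.ofReal_one]
          congr 1; field_simp; ring
      _ ≤ 2 * (ENNReal.ofReal (l / 2 ^ k)⁻¹ * volume {y | t (k + 1) ≤ |u y|}) := by
          gcongr; exact hge k hk
      _ = 2 * ∫⁻ y in {y | t (k + 1) ≤ |u y|}, ENNReal.ofReal (l / 2 ^ k)⁻¹ := by
          rw [setLIntegral_const]
      _ ≤ _ := by
          gcongr with y
          refine ofReal_inv_le_lintegral_kernel (measurableSet_le hu.abs measurable_const)
            (by positivity) ?_ y
          simpa only [compl_ofPred, not_le] using hle k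
  refine le_trans ?_ (mul_le_mul_right (sum_gap_rpow_mul_interaction_le_energy hp hu ht n) 2)
  rw [ENNReal.ofReal_sum_of_nonneg fun k _ => hgap k, Finset.mul_sum]
  refine Finset.sum_le_sum fun k _ => ?_
  rcases (ht k.le_succ).eq_or_lt with hk | hk
  · simp [← hk, (by linarith : p ≠ 0)]
  · rw [mul_left_comm]
    exact le_mul_of_one_le_right zero_le (hinteraction k hk)

theorem rpow_le_of_sum_gap_rpow_le {p M : ℝ} (hp : 1 < p) {t : ℕ → ℝ} (h0 : t 0 = 0)
    (ht : Monotone t) {n : ℕ} (h : ∑ k ∈ Finset.range n, (t (k + 1) - t k) ^ p ≤ M) :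
    t n ^ (p / (p - 1)) ≤ M ^ (1 / (p - 1)) * n := by
  have hp1 : 0 < p - 1 := by linarith
  have htn : 0 ≤ t n := h0 ▸ ht n.zero_le
  have hgap (k : ℕ) : 0 ≤ t (k + 1) - t k := sub_nonneg.2 (ht k.le_succ)
  have hM : 0 ≤ M := (Finset.sum_nonneg fun k _ => rpow_nonneg (hgap k) p).trans h
  have hholder : t n ^ p ≤ n ^ (p - 1) * M := by
    have hpow := rpow_sum_le_const_mul_sum_rpow_of_nonneg (Finset.range n) hp.le
      fun k _ => hgap k
    rw [Finset.sum_range_sub, h0, sub_zero, Finset.card_range] at hpow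
    exact hpow.trans (by gcongr)
  calc t n ^ (p / (p - 1)) = (t n ^ p) ^ (1 / (p - 1)) := by rw [← rpow_mul htn, mul_one_div]
    _ ≤ (n ^ (p - 1) * M) ^ (1 / (p - 1)) := by gcongr
    _ = M ^ (1 / (p - 1)) * n := by
        rw [mul_rpow (by positivity) hM, ← rpow_mul n.cast_nonneg, mul_one_div_cancel hp1.ne',
          rpow_one, mul_comm]

theorem lintegral_comp_le_tsum_of_levels {X : Type*} [MeasurableSpace X] {μ : Measure X}
    {f : X → ℝ} (hf : Measurable f) (hf0 : ∀ x, 0 ≤ f x) {Φ : ℝ → ℝ≥0∞}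
    (hΦ : MonotoneOn Φ (Ici 0)) (hΦ0 : Φ 0 ≠ 0) {t : ℕ → ℝ} (h0 : t 0 = 0) (ht : Monotone t) :
    ∫⁻ x, Φ (f x) ∂μ ≤ Φ 0 * μ univ + ∑' k, Φ (t (k + 1)) * μ {x | t k < f x} := by
  have htn (k : ℕ) : 0 ≤ t k := h0 ▸ ht k.zero_le
  have hmeas (k : ℕ) : MeasurableSet {x | t k < f x} := measurableSet_lt measurable_const hf
  have hpoint (x : X) : Φ (f x) ≤
      Φ 0 + ∑' k, {x | t k < f x}.indicator (fun _ => Φ (t (k + 1))) x := by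
    by_cases hall : ∀ k, t k < f x
    · have hterm (k : ℕ) : Φ 0 ≤ {x | t k < f x}.indicator (fun _ => Φ (t (k + 1))) x := by
        rw [indicator_of_mem (mem_ofPred_eq ▸ hall k)]
        exact hΦ self_mem_Ici (htn _) (htn _)
      have htop := ENNReal.tsum_le_tsum hterm
      rw [ENNReal.tsum_const_eq_top_of_ne_zero hΦ0, top_le_iff] at htop
      simp [htop]
    · push Not at hall
      classical
      have hle : f x ≤ t (Nat.find hall) := Nat.find_spec hall
      rcases hfind : Nat.find hall with _ | k
      · rw [hfind, h0] at hle
        exact (hΦ (hf0 x) self_mem_Ici hle).trans le_self_add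
      · rw [hfind] at hle
        have hlt : t k < f x := not_le.1 (Nat.find_min hall (hfind ▸ k.lt_succ_self))
        refine (hΦ (hf0 x) (htn _) hle).trans
          (le_add_left ((le_of_eq ?_).trans (ENNReal.le_tsum k)))
        rw [indicator_of_mem (mem_ofPred_eq ▸ hlt)]
  refine (lintegral_mono hpoint).trans_eq ?_
  rw [lintegral_add_left measurable_const, lintegral_const,
    lintegral_tsum fun k => (measurable_const.indicator (hmeas k)).aemeasurable]
  simp_rw [lintegral_indicator_const (hmeas _)]

theorem tsum_exp_mul_pow_lt_top {l β : ℝ} (hβ : β < log 2) :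
    ∑' k : ℕ, ENNReal.ofReal (exp (β * (k + 1))) * ENNReal.ofReal (l / 2 ^ k) < ⊤ := by
  have hterm (k : ℕ) : ENNReal.ofReal (exp (β * (k + 1))) * ENNReal.ofReal (l / 2 ^ k) =
      ENNReal.ofReal (l * exp β * (exp β / 2) ^ k) := by
    rw [← ENNReal.ofReal_mul (exp_pos _).le, mul_add_one, exp_add, mul_comm β, exp_nat_mul, div_pow]
    congr 1; ring
  have hratio : exp β / 2 < 1 := by rwa [div_lt_one two_pos, ← lt_log_iff_exp_lt two_pos]
  simp_rw [hterm]
  exact ((summable_geometric_of_lt_one (by positivity) hratio).mul_left _).tsum_ofReal_lt_top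

theorem exists_levels_of_energy_le_one {p : ℝ} (hp : 1 < p) {u : ℝ → ℝ} (hu : Measurable u)
    {l : ℝ} (hl : 0 < l) (hvol : volume {x | 0 < |u x|} ≤ ENNReal.ofReal l)
    (hE : energy p u ≤ 1) :
    ∃ t : ℕ → ℝ, t 0 = 0 ∧ Monotone t ∧
      (∀ k, volume {x | t k < |u x|} ≤ ENNReal.ofReal (l / 2 ^ k)) ∧
      ∀ n : ℕ, t n ^ (p / (p - 1)) ≤ 2 ^ (1 / (p - 1)) * n := by
  have hIoi (r : ℝ) : volume.map (fun x => |u x|) (Ioi r) = volume {x | r < |u x|} :=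
    Measure.map_apply hu.abs measurableSet_Ioi
  have hIci (r : ℝ) : volume.map (fun x => |u x|) (Ici r) = volume {x | r ≤ |u x|} :=
    Measure.map_apply hu.abs measurableSet_Ici
  obtain ⟨t, h0, ht, hle, hge⟩ := exists_dyadic_levels hl ((hIoi 0).trans_le hvol)
  simp only [hIoi, hIci] at hle hge
  refine ⟨t, h0, ht, hle, fun n => rpow_le_of_sum_gap_rpow_le hp h0 ht ?_⟩
  rw [← ENNReal.ofReal_le_ofReal_iff zero_le_two]
  calc _ ≤ 2 * energy p u := sum_gap_rpow_le_two_mul_energy hp.le hu hl ht hle hge n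
    _ ≤ 2 * 1 := by gcongr
    _ = ENNReal.ofReal 2 := by simp

theorem setLIntegral_exp_le_of_energy_le_one {p α : ℝ} (hp : 1 < p) (hα : 0 ≤ α) {u : ℝ → ℝ}
    (hu : Measurable u) {l : ℝ} (hl : 0 < l) (hvol : volume {x | 0 < |u x|} ≤ ENNReal.ofReal l)
    (hE : energy p u ≤ 1) (I : Set ℝ) :
    ∫⁻ x in I, ENNReal.ofReal (exp (α * |u x| ^ (p / (p - 1)))) ≤
      volume I + ∑' k : ℕ, ENNReal.ofReal (exp (α * 2 ^ (1 / (p - 1)) * (k + 1))) *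
        ENNReal.ofReal (l / 2 ^ k) := by
  have hq : 0 < p / (p - 1) := div_pos (by linarith) (by linarith)
  obtain ⟨t, h0, ht, hle, hgrowth⟩ := exists_levels_of_energy_le_one hp hu hl hvol hE
  have hmono : MonotoneOn (fun r : ℝ => ENNReal.ofReal (exp (α * r ^ (p / (p - 1))))) (Ici 0) :=
    fun r (hr : 0 ≤ r) r' _ hrr' => by beta_reduce; gcongr
  have hterm (k : ℕ) : ENNReal.ofReal (exp (α * t (k + 1) ^ (p / (p - 1)))) ≤
      ENNReal.ofReal (exp (α * 2 ^ (1 / (p - 1)) * (k + 1))) := by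
    have hk := hgrowth (k + 1)
    push_cast at hk
    rw [mul_assoc]
    gcongr
  refine (lintegral_comp_le_tsum_of_levels hu.abs (fun x => abs_nonneg (u x)) hmono (by positivity)
    h0 ht).trans ?_
  simp only [zero_rpow hq.ne', mul_zero, exp_zero, ENNReal.ofReal_one, one_mul,
    Measure.restrict_apply_univ]
  exact add_le_add_right (ENNReal.tsum_le_tsum fun k =>
    mul_le_mul' (hterm k) ((Measure.restrict_le_self _).trans (hle k))) _

theorem moserTrudingerSup_lt_top {s p α : ℝ} (hp : 1 < p) (hsp : s * p = 1) (hα : 0 ≤ α)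
    (hα' : α < log 2 / 2 ^ (1 / (p - 1))) {I : Set ℝ} (hI : volume I < ⊤) :
    moserTrudingerSup s p α I < ⊤ := by
  have hp0 : 0 < p := by linarith
  have hexp : 1 / (1 - s) = p / (p - 1) := by
    rw [eq_one_div_of_mul_eq_one_left hsp, one_sub_div hp0.ne', one_div_div]
  obtain ⟨l, -, hIl, -⟩ := ENNReal.lt_iff_exists_real_btwn.1 hI
  have hl : 0 < l := ENNReal.ofReal_pos.1 (zero_le.trans_lt hIl)
  rw [lt_div_iff₀ (by positivity)] at hα'
  refine lt_of_le_of_lt (iSup₂_le fun u ⟨hu, hgag⟩ => ?_)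
    (ENNReal.add_lt_top.2 ⟨hI, tsum_exp_mul_pow_lt_top (l := l) hα'⟩)
  obtain ⟨v, hv, huv⟩ := hu.1.1.1
  have hE : energy p v ≤ 1 := by
    rwa [← energy_congr_ae huv, ← gagliardo_le_one_iff hp0]
  have hvol : volume {x | 0 < |v x|} ≤ ENNReal.ofReal l := by
    refine (measure_mono_ae ?_).trans hIl.le
    filter_upwards [hu.ae_eq_zero hp0, huv] with x hx hxv (hpos : 0 < |v x|)
    by_contra hxI
    rw [← hxv, hx hxI, abs_zero] at hpos
    exact lt_irrefl _ hpos
  calc expIntegral s α I u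
      = ∫⁻ x in I, ENNReal.ofReal (exp (α * |v x| ^ (p / (p - 1)))) := by
        refine lintegral_congr_ae (ae_restrict_of_ae ?_)
        filter_upwards [huv] with x hx
        rw [hx, hexp]
    _ ≤ _ := setLIntegral_exp_le_of_energy_le_one hp hα hv.measurable hl hvol hE I

theorem theorem1p1_general {s p : ℝ} (hp : 1 < p) (hsp : s * p = 1) :
    (∃ αs : ℝ, 0 < αs ∧ ∀ I : Set ℝ, volume I < ⊤ → ∀ α : ℝ, 0 ≤ α → α < αs →
      moserTrudingerSup s p α I < ⊤) ∧
    ∀ I : Set ℝ, (interior I).Nonempty → ∀ α : ℝ, gammaConst p ^ (s / (1 - s)) < α →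
      moserTrudingerSup s p α I = ⊤ :=
  ⟨⟨log 2 / 2 ^ (1 / (p - 1)), div_pos (log_pos one_lt_two) (by positivity),
      fun _ hI _ hα hα' => moserTrudingerSup_lt_top hp hsp hα hα' hI⟩,
    fun _ hI _ hα => moserTrudingerSup_eq_top hp hsp hα hI⟩

end FracMT

theorem theorem1p1 (s p : ℝ) (hs0 : 0 < s) (hs1 : s < 1) (hp : 1 < p) (hsp : s * p = 1) :
    (∃ αs : ℝ, 0 < αs ∧
      ∀ a b : ℝ, a < b → ∀ α : ℝ, 0 ≤ α → α < αs →
        FracMT.moserTrudingerSup s p α (Set.Ioo a b) < ⊤) ∧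
    (∀ a b : ℝ, a < b → ∀ α : ℝ, FracMT.gammaConst p ^ (s / (1 - s)) < α →
        FracMT.moserTrudingerSup s p α (Set.Ioo a b) = ⊤) := by
  obtain ⟨⟨αs, hαs, hfin⟩, htop⟩ := FracMT.theorem1p1_general hp hsp
  exact ⟨⟨αs, hαs, fun a b _ => hfin _ measure_Ioo_lt_top⟩,
    fun a b hab => htop _ (by rwa [interior_Ioo, Set.nonempty_Ioo])⟩
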